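/- Let $k$ be a commutative ring. For finite sets $X,Y$, a correspondence from $X$ to $Y$ is a subset of $Y\times X$; the composite of $Q\subseteq Z\times Y$ and $S\subseteq Y\times X$ is $QS=\{(z,x)\mid \exists y\in Y,\ (z,y)\in Q,\ (y,x)\in S\}$. Let $\mathcal C$ be the category of finite sets and correspondences, $\mathcal C(Y,X)$ the set of correspondences from $X$ to $Y$, and $k\mathcal C$ the $k$-linearization of $\mathcal C$. A correspondence functor is a $k$-linear functor $k\mathcal C\to k\text{-Mod}$; morphisms are natural transformations. *Fundamental functors.* Let $(E,R)$ be a finite poset, where $(a,b)\in R$ means $a\le_R b$. Let $I_E$ be the two-sided ideal of $k\mathcal C(E,E)$ generated by the relations which factor through a set of cardinality smaller than $|E|$, and let $\mathcal P_E$ (the algebra of permuted orders) be the quotient of $k\mathcal C(E,E)/I_E$ by the two-sided ideal generated by the classes of $S-\overline S$, where $S$ is a reflexive relation on $E$ and $\overline S$ is its transitive closure. Let $f_R=\sum_{S\supseteq R}\mu(R,S)\,S\in\mathcal P_E$, where $S$ runs over the partial orders on $E$ containing $R$ and $\mu$ is the Möbius function of the set of all partial orders on $E$, ordered by inclusion.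 The left ideal $\mathcal P_Ef_R$ is a left $k\mathcal C(E,E)$-module. For a left $k\mathcal C(E,E)$-module $W$, set $L_{E,W}=k\mathcal C(-,E)\otimes_{k\mathcal C(E,E)}W$ and $$J_{E,W}(X)=\Big\{\sum_i\phi_i\otimes w_i\in L_{E,W}(X)\ \Big|\ \forall\psi\in k\mathcal C(E,X),\ \sum_i(\psi\phi_i)\cdot w_i=0\Big\}.$$ The fundamental functor of $(E,R)$ is $\mathbb S_{E,R}=L_{E,\mathcal P_Ef_R}/J_{E,\mathcal P_Ef_R}$. *Functors of lattices.* For a finite (nonempty) lattice $T$, the correspondence functor $F_T$ maps a finite set $X$ to the free $k$-module with basis the set of all maps $X\to T$, and a correspondence $Q\subseteq Y\times X$ sends $\varphi:X\to T$ to the map $Y\to T$, $y\mapsto\bigvee_{(y,x)\in Q}\varphi(x)$. For the opposite lattice $T^{op}$, the action of $Q$ on $F_{T^{op}}$ is written $Q\star\psi$; thus $(Q\star\psi)(y)=\bigwedge_{(y,x)\in Q}\psi(x)$, with the meet taken in $T$. **Theorem.** Let $T$ be a finite lattice and let $(E,R)$ be the full subposet of its (join-)irreducible elements. For $t\in T$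 let $r(t)=\bigvee_{s<t}s$. For $A\subseteq E$ let $\eta_A^\circ:E\to T^{op}$ be the map given by $\eta_A^\circ(e)=r(e)$ if $e\in A$ and $\eta_A^\circ(e)=e$ if $e\notin A$, and let $$\gamma_T=\sum_{A\subseteq E}(-1)^{|A|}\eta_A^\circ\in F_{T^{op}}(E).$$ (a) The subfunctor $\langle\gamma_T\rangle$ of $F_{T^{op}}$ generated by $\gamma_T$ is isomorphic to $\mathbb S_{E,R}$. (b) In other words, for every finite set $X$, the module $\langle\gamma_T\rangle(X)$ is the $k$-submodule of $F_{T^{op}}(X)$ generated by the elements $S\star\gamma_T$ for $S\subseteq X\times E$, and $\mathbb S_{E,R}(X)$ is isomorphic to this submodule. -/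

import Mathlib

open CategoryTheory
open scoped TensorProduct

universe u v w

noncomputable section

/-! ### Subfunctors and quotients of functors with values in modules -/

section Subfunctors

variable {k : Type v} [CommRing k] {D : Type u} [Category.{w} D]

/-- A subfunctor of a functor with values in `k`-modules. -/
structure ModSubfunctor (F : D ⥤ ModuleCat.{w} k) where
  /-- The evaluation of the subfunctor at an object. -/
  obj (X : D) : Submodule k (F.obj X)
  map_mem {X Y : D} (f : X ⟶ Y) {x : F.obj X} (hx : x ∈ obj X) : (F.map f).hom x ∈ obj Y

namespace ModSubfunctor

variable {F : D ⥤ ModuleCat.{w} k}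

/-- A subfunctor, regarded as a functor. -/
def toFunctor (G : ModSubfunctor F) : D ⥤ ModuleCat.{w} k where
  obj X := ModuleCat.of k (G.obj X)
  map f := ModuleCat.ofHom ((F.map f).hom.restrict fun _ hx => G.map_mem f hx)
  map_id X := by ext x; simp
  map_comp f g := by ext x; simp

/-- The quotient of a functor by a subfunctor. -/
def quotient (G : ModSubfunctor F) : D ⥤ ModuleCat.{w} k where
  obj X := ModuleCat.of k (F.obj X ⧸ G.obj X)
  map {X Y} f := ModuleCat.ofHom
    ((G.obj X).mapQ (G.obj Y) (F.map f).hom fun _ hx => G.map_mem f hx)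
  map_id X := by
    ext x
    simp
  map_comp f g := by
    ext x
    simp

/-- The subfunctor of `F` generated by `x ∈ F(E)`: the intersection of all the subfunctors `G`
of `F` such that `x ∈ G(E)`. -/
def generatedBy (F : D ⥤ ModuleCat.{w} k) {E : D} (x : F.obj E) : ModSubfunctor F where
  obj X := ⨅ (G : ModSubfunctor F) (_ : x ∈ G.obj E), G.obj X
  map_mem f y hy := by
    simp only [Submodule.mem_iInf] at hy ⊢
    exact fun G hG => G.map_mem f (hy G hG)

section Linear

variable [Preadditive D] [Linear k D] [F.Additive] [F.Linear k] (G : ModSubfunctor F)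

instance : G.toFunctor.Additive where
  map_add {X Y f g} := by
    refine ModuleCat.hom_ext (LinearMap.ext fun x => Subtype.ext ?_)
    exact congrArg (fun h => h.hom x.1) (F.map_add (f := f) (g := g))

instance : G.toFunctor.Linear k where
  map_smul {X Y} f r := by
    refine ModuleCat.hom_ext (LinearMap.ext fun x => Subtype.ext ?_)
    exact congrArg (fun h => h.hom x.1) (Functor.Linear.map_smul (F := F) f r)

instance : G.quotient.Additive where
  map_add {X Y f g} := by
    refine ModuleCat.hom_ext (Submodule.linearMap_qext _ (LinearMap.ext fun x => ?_))
    exact congrArg (fun h => (G.obj Y).mkQ (h.hom x)) (F.map_add (f := f) (g := g))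

instance : G.quotient.Linear k where
  map_smul {X Y} f r := by
    refine ModuleCat.hom_ext (Submodule.linearMap_qext _ (LinearMap.ext fun x => ?_))
    exact congrArg (fun h => (G.obj Y).mkQ (h.hom x)) (Functor.Linear.map_smul (F := F) f r)

end Linear

end ModSubfunctor

end Subfunctors

/-! ### The functors `L_{E,W}` and `J_{E,W}` -/

section Induction

variable (k : Type v) [CommRing k] {D : Type u} [Category.{w} D] [Preadditive D] [Linear k D]
  (E : D) (W : Type w) [AddCommGroup W] [Module k W] [Module (End E) W] [IsScalarTower k (End E) W]


/-- The submodule of `Hom(E, X) ⊗_k W` spanned by the elements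
`(φ ∘ a) ⊗ w - φ ⊗ (a • w)`, for `a ∈ End(E)`. -/
def balancingSubmodule (X : D) : Submodule k ((E ⟶ X) ⊗[k] W) :=
  Submodule.span k {t | ∃ (φ : E ⟶ X) (a : End E) (m : W),
    t = (a.asHom ≫ φ) ⊗ₜ[k] m - φ ⊗ₜ[k] (a • m)}

/-- The tensor product `Hom(E, X) ⊗_{End(E)} W`, as a `k`-module. -/
abbrev EndTensor (X : D) : Type w :=
  ((E ⟶ X) ⊗[k] W) ⧸ balancingSubmodule k E W X

/-- The map `Hom(E, X) ⊗_{End(E)} W → Hom(E, Y) ⊗_{End(E)} W` sending `φ ⊗ w` to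
`(α ∘ φ) ⊗ w`. -/
def endTensorMap {X Y : D} (α : X ⟶ Y) : EndTensor k E W X →ₗ[k] EndTensor k E W Y :=
  Submodule.mapQ _ _ (LinearMap.rTensor W (Linear.rightComp k E α)) <| by
    refine Submodule.span_le.2 ?_
    rintro _ ⟨φ, a, m, rfl⟩
    refine Submodule.subset_span ⟨φ ≫ α, a, m, ?_⟩
    simp [Linear.rightComp]

/-- The functor `L_{E,W} = Hom(E, -) ⊗_{End(E)} W`. -/
def inducedFunctorL : D ⥤ ModuleCat.{w} k where
  obj X := ModuleCat.of k (EndTensor k E W X)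
  map α := ModuleCat.ofHom (endTensorMap k E W α)
  map_id X := by
    refine ModuleCat.hom_ext (Submodule.linearMap_qext _ (TensorProduct.ext' fun φ m => ?_))
    simp [endTensorMap, Linear.rightComp]
  map_comp α β := by
    refine ModuleCat.hom_ext (Submodule.linearMap_qext _ (TensorProduct.ext' fun φ m => ?_))
    simp [endTensorMap, Linear.rightComp]

lemma endTensorMap_add {X Y : D} (α β : X ⟶ Y) :
    endTensorMap k E W (α + β) = endTensorMap k E W α + endTensorMap k E W β := by
  refine Submodule.linearMap_qext _ (TensorProduct.ext' fun φ m => ?_)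
  simp [endTensorMap, Linear.rightComp, TensorProduct.add_tmul]

lemma endTensorMap_smul {X Y : D} (r : k) (α : X ⟶ Y) :
    endTensorMap k E W (r • α) = r • endTensorMap k E W α := by
  refine Submodule.linearMap_qext _ (TensorProduct.ext' fun φ m => ?_)
  simp [endTensorMap, Linear.rightComp, ← TensorProduct.smul_tmul']

instance : (inducedFunctorL k E W).Additive where
  map_add := ModuleCat.hom_ext (endTensorMap_add k E W _ _)

instance : (inducedFunctorL k E W).Linear k where
  map_smul f r := ModuleCat.hom_ext (endTensorMap_smul k E W r f)

/-- For `ψ : X ⟶ E`, the map `Hom(E, X) ⊗_{End(E)} W → W` sending `φ ⊗ w` to `(ψ ∘ φ) • w`. -/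
def evalAgainst {X : D} (ψ : X ⟶ E) : EndTensor k E W X →ₗ[k] W :=
  Submodule.liftQ _
    (TensorProduct.lift
      (((Algebra.lsmul k k W).toLinearMap : End E →ₗ[k] Module.End k W) ∘ₗ
        (Linear.rightComp k E ψ : (E ⟶ X) →ₗ[k] End E))) <| by
    refine Submodule.span_le.2 ?_
    rintro _ ⟨φ, a, m, rfl⟩
    have h : (End.of ((a.asHom ≫ φ) ≫ ψ)) • m = (End.of (φ ≫ ψ)) • (a • m) := by
      rw [smul_smul, End.mul_def, Category.assoc]
    simpa [Linear.rightComp, sub_eq_zero] using h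

lemma evalAgainst_comp_endTensorMap {X Y : D} (α : X ⟶ Y) (ψ : Y ⟶ E) :
    evalAgainst k E W ψ ∘ₗ endTensorMap k E W α = evalAgainst k E W (α ≫ ψ) := by
  refine Submodule.linearMap_qext _ (TensorProduct.ext' fun φ m => ?_)
  simp [endTensorMap, evalAgainst, Linear.rightComp]

/-- The submodule `J_{E,W}(X)` of `L_{E,W}(X)`: an element `∑ φᵢ ⊗ wᵢ` of `L_{E,W}(X)` belongs to
`J_{E,W}(X)` if and only if `∑ (ψ ∘ φᵢ) • wᵢ = 0` for all `ψ : X ⟶ E`. -/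
def submoduleJ (X : D) : Submodule k (EndTensor k E W X) :=
  ⨅ ψ : X ⟶ E, LinearMap.ker (evalAgainst k E W ψ)

lemma mem_submoduleJ {X : D} (x : EndTensor k E W X) :
    x ∈ submoduleJ k E W X ↔ ∀ ψ : X ⟶ E, evalAgainst k E W ψ x = 0 := by
  simp [submoduleJ]

lemma endTensorMap_mem_submoduleJ {X Y : D} (α : X ⟶ Y) {x : EndTensor k E W X}
    (hx : x ∈ submoduleJ k E W X) : endTensorMap k E W α x ∈ submoduleJ k E W Y := by
  rw [mem_submoduleJ] at hx ⊢
  intro ψ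
  rw [← hx (α ≫ ψ), ← evalAgainst_comp_endTensorMap, LinearMap.comp_apply]

/-- The subfunctor `J_{E,W}` of `L_{E,W}`. -/
def inducedSubfunctorJ : ModSubfunctor (inducedFunctorL k E W) where
  obj X := submoduleJ k E W X
  map_mem α _ hx := endTensorMap_mem_submoduleJ k E W α hx

end Induction

/-! ### The category of finite sets and correspondences -/

/-- The objects of the category of finite sets and correspondences. -/
structure FinCorr : Type (u + 1) where
  /-- The underlying set. -/
  carrier : Type u
  [finite : Finite carrier]

namespace FinCorr

instance : CoeSort FinCorr.{u} (Type u) := ⟨FinCorr.carrier⟩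

attribute [instance] FinCorr.finite

/-- The morphisms from `X` to `Y` are the correspondences, i.e. the subsets of `Y × X`. The
composite of `S ⊆ Y × X` followed by `R ⊆ Z × Y` is the set of all `(z, x)` such that
`(z, y) ∈ R` and `(y, x) ∈ S` for some `y`. -/
instance : Category.{u} FinCorr.{u} where
  Hom X Y := Set (Y × X)
  id X := {p | p.1 = p.2}
  comp {X Y Z} S R := {p | ∃ y : Y, (p.1, y) ∈ R ∧ (y, p.2) ∈ S}
  id_comp S := by ext ⟨y, x⟩; simp
  comp_id S := by ext ⟨y, x⟩; simp
  assoc S R Q := by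
    ext ⟨y, x⟩
    constructor
    · rintro ⟨c, hc, b, hb, ha⟩
      exact ⟨b, ⟨c, hc, hb⟩, ha⟩
    · rintro ⟨b, ⟨c, hc, hb⟩, ha⟩
      exact ⟨c, hc, b, hb, ha⟩

end FinCorr

/-- The `k`-linearization of the category of finite sets and correspondences. A correspondence
functor over `k` is a `k`-linear functor from this category to `k`-modules, and a morphism of
correspondence functors is a natural transformation. -/
abbrev LinCorr (k : Type v) [CommRing k] := Free k FinCorr.{u}

/-- A finite set, as an object of the linearized category of correspondences. -/
abbrev LinCorr.of (k : Type v) [CommRing k] (X : Type u) [Finite X] : LinCorr.{u, v} k :=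
  Free.of k (FinCorr.mk X)

/-- A correspondence `Q ⊆ Y × X`, as a morphism from `X` to `Y` in the linearized category. -/
def LinCorr.corr (k : Type v) [CommRing k] {X Y : Type u} [Finite X] [Finite Y]
    (Q : Set (Y × X)) : LinCorr.of k X ⟶ LinCorr.of k Y :=
  (Free.embedding k FinCorr).map (X := FinCorr.mk X) (Y := FinCorr.mk Y) Q

/-! ### The algebra of relations, the algebra of permuted orders, the fundamental functor -/

section Fundamental

variable (k : Type v) [CommRing k] (E : Type u) [Finite E]

/-- The algebra `k𝒞(E, E)` of all relations on `E`. -/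
abbrev RelAlg : Type (max u v) := End (LinCorr.of k E)

/-- A relation on `E`, as an element of the algebra of relations. -/
def RelAlg.rel {E : Type u} [Finite E] (Q : Set (E × E)) : RelAlg k E := LinCorr.corr k Q

/-- A relation on `E` is inessential if it factors through a set with fewer elements than `E`. -/
def IsInessential {E : Type u} [Finite E] (Q : Set (E × E)) : Prop :=
  ∃ (Y : FinCorr.{u}) (S : FinCorr.mk E ⟶ Y) (R : Y ⟶ FinCorr.mk E),
    Nat.card Y < Nat.card E ∧ S ≫ R = Q

/-- The two-sided ideal `I_E` of `k𝒞(E, E)` generated by the inessential relations. The quotient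
by this ideal is the essential algebra. -/
def inessentialIdeal : TwoSidedIdeal (RelAlg k E) :=
  TwoSidedIdeal.span {a | ∃ Q : Set (E × E), IsInessential Q ∧ a = RelAlg.rel k Q}

/-- The transitive closure of a relation. -/
def transClosure {E : Type u} (Q : Set (E × E)) : Set (E × E) :=
  {p | Relation.TransGen (fun a b => (a, b) ∈ Q) p.1 p.2}

/-- The two-sided ideal of `k𝒞(E, E)` generated by the differences `S - S̄`, where `S` is a
reflexive relation on `E` and `S̄` is its transitive closure. Its image in the essential algebra
is the nilpotent ideal `N` which defines the algebra of permuted orders. -/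
def closureIdeal : TwoSidedIdeal (RelAlg k E) :=
  TwoSidedIdeal.span {a | ∃ S : Set (E × E), (∀ e, (e, e) ∈ S) ∧
    a = RelAlg.rel k S - RelAlg.rel k (transClosure S)}

/-- The algebra `𝒫_E` of permuted orders: the quotient of the essential algebra `k𝒞(E, E) / I_E`
by the image `N` of the ideal generated by all the `S - S̄`. -/
abbrev PermOrderAlg : Type (max u v) :=
  (inessentialIdeal k E ⊔ closureIdeal k E).ringCon.Quotient

/-- The canonical surjection `k𝒞(E, E) → 𝒫_E`. -/
def PermOrderAlg.proj : RelAlg k E →+* PermOrderAlg k E :=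
  (inessentialIdeal k E ⊔ closureIdeal k E).ringCon.mk'

/-- The order relations on `E`, ordered by inclusion; `(a, b) ∈ R` means `a ≤ b` for `R`. -/
abbrev OrderRel (E : Type u) : Type u :=
  {R : Set (E × E) // (∀ a, (a, a) ∈ R) ∧ (∀ a b, (a, b) ∈ R → (b, a) ∈ R → a = b) ∧
    ∀ a b c, (a, b) ∈ R → (b, c) ∈ R → (a, c) ∈ R}

variable {E}

open Classical in
/-- The idempotent `f_R = ∑_{S ⊇ R} μ(R, S) S` of `𝒫_E` associated with an order `R` on `E`, where
`S` runs over the orders on `E` containing `R`, and `μ` is the Möbius function of the poset of all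
orders on `E`. -/
def fundIdempotent (R : OrderRel E) : PermOrderAlg k E :=
  letI : Fintype (OrderRel E) := Fintype.ofFinite _
  letI : LocallyFiniteOrder (OrderRel E) := Fintype.toLocallyFiniteOrder
  ∑ S : OrderRel E, if R ≤ S then
    IncidenceAlgebra.mu k R S • PermOrderAlg.proj k E (RelAlg.rel k S.1) else 0

/-- The fundamental module `𝒫_E f_R`: the left ideal of `𝒫_E` generated by `f_R`. -/
def FundModule (R : OrderRel E) : Type (max u v) :=
  ↥(Ideal.span {fundIdempotent k R} : Ideal (PermOrderAlg k E))

instance (R : OrderRel E) : AddCommGroup (FundModule k R) :=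
  inferInstanceAs (AddCommGroup ↥(Ideal.span {fundIdempotent k R} : Ideal (PermOrderAlg k E)))

instance (R : OrderRel E) : Module (PermOrderAlg k E) (FundModule k R) :=
  inferInstanceAs
    (Module (PermOrderAlg k E) ↥(Ideal.span {fundIdempotent k R} : Ideal (PermOrderAlg k E)))

instance (R : OrderRel E) : Module k (FundModule k R) :=
  inferInstanceAs (Module k ↥(Ideal.span {fundIdempotent k R} : Ideal (PermOrderAlg k E)))

/-- The action of relations on the fundamental module, through `k𝒞(E, E) → 𝒫_E`. -/
instance (R : OrderRel E) : Module (RelAlg k E) (FundModule k R) :=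
  Module.compHom (FundModule k R) (PermOrderAlg.proj k E)

instance (R : OrderRel E) : IsScalarTower k (RelAlg k E) (FundModule k R) where
  smul_assoc c a m := by
    have h : PermOrderAlg.proj k E (c • a) = c • PermOrderAlg.proj k E a := rfl
    have h' : (c • a) • m = PermOrderAlg.proj k E (c • a) • m := rfl
    rw [h', h]
    exact Subtype.ext (smul_mul_assoc c (PermOrderAlg.proj k E a) m.1)

/-- The fundamental functor `𝕊_{E,R} = L_{E,𝒫_E f_R} / J_{E,𝒫_E f_R}` associated with a finite
poset `(E, R)`. -/
def fundamentalFunctor (R : OrderRel E) : LinCorr.{u, v} k ⥤ ModuleCat.{max u v} k :=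
  (inducedSubfunctorJ k (LinCorr.of k E) (FundModule k R)).quotient

instance (R : OrderRel E) : (fundamentalFunctor k R).Additive := by
  unfold fundamentalFunctor; infer_instance

instance (R : OrderRel E) : (fundamentalFunctor k R).Linear k := by
  unfold fundamentalFunctor; infer_instance

end Fundamental

/-! ### The functor associated with a lattice -/

section Lattice

variable (k : Type v) [CommRing k]

/-- The action of a correspondence `Q ⊆ Y × X` on a map `φ : X → T`:
`(Qφ)(y)` is the join of all `φ(x)` with `(y, x) ∈ Q`. -/
def corrAct {T : Type u} [SemilatticeSup T] [OrderBot T] {X Y : Type u} [Finite X]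
    (Q : Set (Y × X)) (φ : X → T) : Y → T :=
  fun y => (Set.toFinite {x | (y, x) ∈ Q}).toFinset.sup φ

lemma corrAct_le_iff {T : Type u} [SemilatticeSup T] [OrderBot T] {X Y : Type u} [Finite X]
    (Q : Set (Y × X)) (φ : X → T) (y : Y) (t : T) :
    corrAct Q φ y ≤ t ↔ ∀ x, (y, x) ∈ Q → φ x ≤ t := by
  simp [corrAct]

lemma corrAct_id {T : Type u} [SemilatticeSup T] [OrderBot T] {X : Type u} [Finite X]
    (φ : X → T) : corrAct {p : X × X | p.1 = p.2} φ = φ := by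
  funext y
  refine eq_of_forall_ge_iff fun t => ?_
  simp [corrAct_le_iff]

lemma corrAct_comp {T : Type u} [SemilatticeSup T] [OrderBot T] {X Y Z : Type u} [Finite X]
    [Finite Y] (R : Set (Z × Y)) (S : Set (Y × X)) (φ : X → T) :
    corrAct {p : Z × X | ∃ y : Y, (p.1, y) ∈ R ∧ (y, p.2) ∈ S} φ = corrAct R (corrAct S φ) := by
  funext z
  refine eq_of_forall_ge_iff fun t => ?_
  simp only [corrAct_le_iff]
  exact ⟨fun h y hy x hx => h x ⟨y, hy, hx⟩, fun h x ⟨y, hy, hx⟩ => h y hy x hx⟩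

/-- The `k`-linear extension of the action of correspondences on maps to `T`, as a linear map from
`k𝒞(Y, X)` to the linear maps `F_T(X) → F_T(Y)`. -/
def corrActLin (T : Type u) [SemilatticeSup T] [OrderBot T] (X Y : LinCorr.{u, v} k) :
    (X ⟶ Y) →ₗ[k] ((FinCorr.carrier X → T) →₀ k) →ₗ[k] ((FinCorr.carrier Y → T) →₀ k) :=
  haveI : Finite (FinCorr.carrier X) := FinCorr.finite X
  Finsupp.linearCombination k
    (fun Q : Set (FinCorr.carrier Y × FinCorr.carrier X) =>
      Finsupp.lmapDomain k k (corrAct (T := T) Q))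

lemma corrActLin_single (T : Type u) [SemilatticeSup T] [OrderBot T] {X Y : FinCorr.{u}}
    (Q : X ⟶ Y) (r s : k) (φ : X → T) :
    corrActLin k T (Free.of k X) (Free.of k Y) (Finsupp.single Q r) (Finsupp.single φ s) =
      Finsupp.single (corrAct Q φ) (r * s) := by
  refine (LinearMap.congr_fun (Finsupp.linearCombination_single k r Q) _).trans ?_
  exact (congrArg (r • ·) Finsupp.mapDomain_single).trans (Finsupp.smul_single r _ s)

lemma corrActLin_id (T : Type u) [SemilatticeSup T] [OrderBot T] (X : LinCorr.{u, v} k) :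
    corrActLin k T X X (𝟙 X) = LinearMap.id := by
  refine Finsupp.lhom_ext fun φ s => ?_
  refine (corrActLin_single k T (@CategoryStruct.id FinCorr.{u} _ X) 1 s φ).trans ?_
  have : Finite (FinCorr.carrier X) := FinCorr.finite X
  rw [one_mul]
  exact congrArg (Finsupp.single · s) (corrAct_id φ)

lemma corrActLin_comp (T : Type u) [SemilatticeSup T] [OrderBot T] {X Y Z : LinCorr.{u, v} k}
    (α : X ⟶ Y) (β : Y ⟶ Z) :
    corrActLin k T X Z (α ≫ β) = corrActLin k T Y Z β ∘ₗ corrActLin k T X Y α := by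
  induction α using Finsupp.induction_linear with
  | zero => exact (congrArg _ (Limits.zero_comp)).trans (by rw [map_zero]; erw [map_zero]; simp)
  | add f g hf hg =>
    refine (congrArg _ (Preadditive.add_comp X Y Z f g β)).trans ?_
    rw [map_add, hf, hg, ← LinearMap.comp_add]
    exact congrArg _ (map_add (corrActLin k T X Y) f g).symm
  | single S r =>
    induction β using Finsupp.induction_linear with
    | zero => exact (congrArg _ (Limits.comp_zero)).trans (by rw [map_zero]; erw [map_zero]; simp)
    | add f g hf hg =>
      refine (congrArg _ (Preadditive.comp_add X Y Z _ f g)).trans ?_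
      rw [map_add, hf, hg, ← LinearMap.add_comp]
      exact congrArg (· ∘ₗ _) (map_add (corrActLin k T Y Z) f g).symm
    | single R s =>
      refine Finsupp.lhom_ext fun φ t => ?_
      refine (congrArg (fun γ => corrActLin k T X Z γ (Finsupp.single φ t))
        (Free.single_comp_single k FinCorr S R r s)).trans ?_
      refine (corrActLin_single k T _ _ _ _).trans ?_
      refine Eq.trans ?_ (congrArg (corrActLin k T Y Z _) (corrActLin_single k T S r t φ)).symm
      refine Eq.trans ?_ (corrActLin_single k T R s _ _).symm
      have : Finite (FinCorr.carrier X) := FinCorr.finite X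
      have : Finite (FinCorr.carrier Y) := FinCorr.finite Y
      rw [show r * s * t = s * (r * t) by ring]
      exact congrArg (Finsupp.single · _) (corrAct_comp R S φ)

/-- The functor `F_T`: its value at `X` is the free `k`-module on the set of all maps `X → T`, and
correspondences act by the `k`-linear extension of `corrAct`. -/
def latticeFunctor (T : Type u) [SemilatticeSup T] [OrderBot T] :
    LinCorr.{u, v} k ⥤ ModuleCat.{max u v} k where
  obj X := ModuleCat.of k ((FinCorr.carrier X → T) →₀ k)
  map {X Y} α := ModuleCat.ofHom (corrActLin k T X Y α)
  map_id X := ModuleCat.hom_ext (corrActLin_id k T X)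
  map_comp α β := ModuleCat.hom_ext (corrActLin_comp k T α β)

instance (T : Type u) [SemilatticeSup T] [OrderBot T] :
    (latticeFunctor.{u, v} k T).Additive where
  map_add {X Y f g} := ModuleCat.hom_ext (map_add (corrActLin k T X Y) f g)

instance (T : Type u) [SemilatticeSup T] [OrderBot T] :
    (latticeFunctor.{u, v} k T).Linear k where
  map_smul {X Y} f r := ModuleCat.hom_ext (map_smul (corrActLin k T X Y) r f)

variable (T : Type u) [Lattice T] [BoundedOrder T] [Finite T]

/-- The set of irreducible elements of a lattice. -/
abbrev Irr (T : Type u) [Lattice T] : Type u := {e : T // SupIrred e}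

/-- The order relation on the full subposet of irreducible elements. -/
def irrOrder (T : Type u) [Lattice T] : OrderRel (Irr T) :=
  ⟨{p | p.1 ≤ p.2}, fun _ => le_refl _, fun _ _ h₁ h₂ => le_antisymm h₁ h₂,
    fun _ _ _ h₁ h₂ => le_trans h₁ h₂⟩

variable {T}

/-- The join of all the elements of `T` strictly smaller than `t`. -/
def rElem (t : T) : T := (Set.toFinite {s | s < t}).toFinset.sup id

open Classical in
/-- The map `η_A : E → T` equal to `r(e)` for `e ∈ A` and to `e` for `e ∉ A`. -/
def etaMap (A : Finset (Irr T)) : Irr T → T :=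
  fun e => if e ∈ A then rElem e.1 else e.1

variable (T)

/-- The element `γ_T = ∑_{A ⊆ E} (-1)^|A| η_A°` of `F_{T^op}(E)`. -/
def gammaElem : (latticeFunctor k Tᵒᵈ).obj (LinCorr.of k (Irr T)) :=
  letI : Fintype (Irr T) := Fintype.ofFinite _
  (∑ A : Finset (Irr T),
    Finsupp.single (fun e => OrderDual.toDual (etaMap A e)) ((-1 : k) ^ A.card) :
      (Irr T → Tᵒᵈ) →₀ k)

end Lattice

end

/-!
For an order `R` on `E`, let `λ_R` be the linear form on `k𝒞(E, E)` which is `1` at the reflexive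
relations contained in `R` and `0` at the other relations. It vanishes on both ideals defining
`𝒫_E`, and the induced form detects the left ideal of `f_R`: for every `a`, `a f_R = 0` if and only
if `λ_R(b a) = 0` for all `b`. Indeed a relation `Q` containing the graph of a permutation `τ` is
`τ (τ⁻¹ Q)` with `τ⁻¹ Q` reflexive, and Möbius inversion shows that a reflexive relation acts on
`f_R` as `1` if it is contained in `R` and as `0` otherwise; the relations containing no permutation
vanish in `𝒫_E`, by Hall's theorem.

On the lattice side, an element of `F_{T^op}(X)` is determined by the sums of its coefficients at
the maps `ψ ≥ φ`, for `φ : X → T`. By inclusion-exclusion, such a sum for `γ_T` is `1` if `φ` is the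
inclusion `E ⊆ T` and `0` otherwise. Since joins and meets are adjoint and every `φ : X → T` is the
image of this inclusion under a correspondence, the sums for `α ⋆ γ_T` are the values of `λ_R` at
the composites of `α` with the correspondences from `X` to `E`. Hence `γ_T` and `f_R` have the same
annihilators, which determines the functors that they generate.
-/

open scoped SetRel

noncomputable section

section CyclicFunctors

lemma exists_linearEquiv_of_ker_eq {k M N P : Type*} [Ring k] [AddCommGroup M] [AddCommGroup N]
    [AddCommGroup P] [Module k M] [Module k N] [Module k P] {p : M →ₗ[k] N} {q : M →ₗ[k] P}
    (hp : Function.Surjective p) (hq : Function.Surjective q)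
    (h : LinearMap.ker p = LinearMap.ker q) : ∃ e : N ≃ₗ[k] P, ∀ m, e (p m) = q m := by
  refine ⟨(p.quotKerEquivOfSurjective hp).symm ≪≫ₗ Submodule.quotEquivOfEq _ _ h ≪≫ₗ
    q.quotKerEquivOfSurjective hq, fun m => ?_⟩
  have hm : (p.quotKerEquivOfSurjective hp).symm (p m) = Submodule.Quotient.mk m := by
    rw [LinearEquiv.symm_apply_eq]
    rfl
  simp only [LinearEquiv.trans_apply, hm]
  rfl

variable {k : Type v} [CommRing k] {D : Type u} [Category.{w} D] [Preadditive D] [Linear k D]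
  {E : D}

section Generated

variable {F : D ⥤ ModuleCat.{w} k} [F.Additive] [F.Linear k]

/-- The map `Hom(E, X) → F(X)`, `α ↦ F(α)(x)`, which corresponds to `x ∈ F(E)` under the Yoneda
lemma. -/
def yonedaMap (x : F.obj E) (X : D) : (E ⟶ X) →ₗ[k] F.obj X where
  toFun α := (F.map α).hom x
  map_add' α β := by rw [F.map_add]; rfl
  map_smul' r α := by rw [F.map_smul]; rfl

lemma yonedaMap_comp (x : F.obj E) {X Y : D} (α : E ⟶ X) (f : X ⟶ Y) :
    yonedaMap x Y (α ≫ f) = (F.map f).hom (yonedaMap x X α) :=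
  congrArg (fun g => g.hom x) (F.map_comp α f)

lemma generatedBy_obj_eq_range (x : F.obj E) (X : D) :
    (ModSubfunctor.generatedBy F x).obj X = LinearMap.range (yonedaMap x X) := by
  apply le_antisymm
  · refine iInf₂_le (⟨fun Y => LinearMap.range (yonedaMap x Y), ?_⟩ : ModSubfunctor F) ?_
    · rintro Y Z f _ ⟨α, rfl⟩
      exact ⟨α ≫ f, yonedaMap_comp x α f⟩
    · exact ⟨𝟙 E, congrArg (fun g => g.hom x) (F.map_id E)⟩
  · rintro _ ⟨α, rfl⟩
    simp only [ModSubfunctor.generatedBy, Submodule.mem_iInf]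
    exact fun G hG => G.map_mem α hG

/-- The surjection `Hom(E, X) → ⟨x⟩(X)`, `α ↦ F(α)(x)`. -/
def toGeneratedBy (x : F.obj E) (X : D) :
    (E ⟶ X) →ₗ[k] (ModSubfunctor.generatedBy F x).obj X :=
  (yonedaMap x X).codRestrict _ fun α => generatedBy_obj_eq_range x X ▸ ⟨α, rfl⟩

lemma toGeneratedBy_surjective (x : F.obj E) (X : D) :
    Function.Surjective (toGeneratedBy x X) := by
  rintro ⟨y, hy⟩
  obtain ⟨α, rfl⟩ := (generatedBy_obj_eq_range x X).le hy
  exact ⟨α, rfl⟩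

lemma toFunctor_map_toGeneratedBy (x : F.obj E) {X Y : D} (f : X ⟶ Y) (α : E ⟶ X) :
    ((ModSubfunctor.generatedBy F x).toFunctor.map f).hom (toGeneratedBy x X α) =
      toGeneratedBy x Y (α ≫ f) :=
  Subtype.ext (yonedaMap_comp x α f).symm

end Generated

section Induced

variable {W : Type w} [AddCommGroup W] [Module k W] [Module (End E) W] [IsScalarTower k (End E) W]

/-- The map `Hom(E, X) → L_{E,W}(X) / J_{E,W}(X)` sending `φ` to the class of `φ ⊗ m`. -/
def tensorClass (m : W) (X : D) : (E ⟶ X) →ₗ[k] (inducedSubfunctorJ k E W).quotient.obj X :=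
  (submoduleJ k E W X).mkQ ∘ₗ (balancingSubmodule k E W X).mkQ ∘ₗ
    (TensorProduct.mk k (E ⟶ X) W).flip m

lemma tensorClass_eq_zero_iff (m : W) {X : D} (α : E ⟶ X) :
    tensorClass (k := k) m X α = 0 ↔ ∀ ψ : X ⟶ E, End.of (α ≫ ψ) • m = 0 := by
  refine (Submodule.Quotient.mk_eq_zero _).trans ?_
  rw [mem_submoduleJ]
  rfl

lemma tensorClass_surjective {m : W} (hm : ∀ x : W, ∃ a : End E, x = a • m) (X : D) :
    Function.Surjective (tensorClass (k := k) (E := E) m X) := by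
  let q : (E ⟶ X) ⊗[k] W →ₗ[k] (inducedSubfunctorJ k E W).quotient.obj X :=
    (submoduleJ k E W X).mkQ ∘ₗ (balancingSubmodule k E W X).mkQ
  have hq : LinearMap.range q ≤ LinearMap.range (tensorClass (k := k) m X) := by
    rw [LinearMap.range_eq_map, ← TensorProduct.span_tmul_eq_top, Submodule.map_span_le]
    rintro _ ⟨φ, x, rfl⟩
    obtain ⟨a, rfl⟩ := hm x
    exact ⟨a.asHom ≫ φ, congrArg (submoduleJ k E W X).mkQ
      ((Submodule.Quotient.eq _).2 (Submodule.subset_span ⟨φ, a, m, rfl⟩))⟩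
  intro y
  obtain ⟨y, rfl⟩ := Submodule.mkQ_surjective _ y
  obtain ⟨y, rfl⟩ := Submodule.mkQ_surjective _ y
  exact hq ⟨y, rfl⟩

lemma quotient_map_tensorClass (m : W) {X Y : D} (f : X ⟶ Y) (α : E ⟶ X) :
    ((inducedSubfunctorJ k E W).quotient.map f).hom (tensorClass m X α) =
      tensorClass m Y (α ≫ f) := rfl

theorem nonempty_generatedBy_iso {F : D ⥤ ModuleCat.{w} k} [F.Additive] [F.Linear k]
    (x : F.obj E) {m : W} (hm : ∀ y : W, ∃ a : End E, y = a • m)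
    (h : ∀ (X : D) (α : E ⟶ X),
      (F.map α).hom x = 0 ↔ ∀ ψ : X ⟶ E, End.of (α ≫ ψ) • m = 0) :
    Nonempty ((ModSubfunctor.generatedBy F x).toFunctor ≅
      (inducedSubfunctorJ k E W).quotient) := by
  have hker (X : D) :
      LinearMap.ker (toGeneratedBy x X) = LinearMap.ker (tensorClass (k := k) m X) := by
    ext α
    rw [LinearMap.mem_ker, LinearMap.mem_ker, tensorClass_eq_zero_iff, ← h]
    exact Subtype.ext_iff
  choose e he using fun X =>
    exists_linearEquiv_of_ker_eq (toGeneratedBy_surjective x X) (tensorClass_surjective hm X)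
      (hker X)
  refine ⟨NatIso.ofComponents (fun X => (e X).toModuleIso) fun {X Y} f => ?_⟩
  refine ModuleCat.hom_ext (LinearMap.ext fun y => ?_)
  obtain ⟨α, rfl⟩ := toGeneratedBy_surjective x X y
  calc e Y (((ModSubfunctor.generatedBy F x).toFunctor.map f).hom (toGeneratedBy x X α))
    _ = e Y (toGeneratedBy x Y (α ≫ f)) :=
      congrArg (e Y) (toFunctor_map_toGeneratedBy x f α)
    _ = tensorClass m Y (α ≫ f) := he Y (α ≫ f)
    _ = ((inducedSubfunctorJ k E W).quotient.map f).hom (tensorClass m X α) :=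
      (quotient_map_tensorClass m f α).symm
    _ = ((inducedSubfunctorJ k E W).quotient.map f).hom (e X (toGeneratedBy x X α)) :=
      congrArg _ (he X α).symm

end Induced

end CyclicFunctors

section Relations

variable {E : Type u}

instance (S : SetRel E E) [S.IsRefl] : SetRel.IsRefl (transClosure S) :=
  ⟨fun _ => Relation.TransGen.single S.rfl⟩

instance (S : SetRel E E) : SetRel.IsTrans (transClosure S) :=
  ⟨fun _ _ _ => Relation.TransGen.trans⟩

lemma subset_transClosure (S : SetRel E E) : S ⊆ transClosure S :=
  fun p (hp : (p.1, p.2) ∈ S) => Relation.TransGen.single hp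

namespace OrderRel

instance (R : OrderRel E) : SetRel.IsRefl R.1 := ⟨R.2.1⟩

instance (R : OrderRel E) : SetRel.IsTrans R.1 := ⟨R.2.2.2⟩

lemma antisymm (R : OrderRel E) {a b : E} (hab : (a, b) ∈ R.1) (hba : (b, a) ∈ R.1) : a = b :=
  R.2.2.1 a b hab hba

lemma transClosure_subset_iff (R : OrderRel E) {S : SetRel E E} :
    transClosure S ⊆ R.1 ↔ S ⊆ R.1 := by
  refine ⟨(subset_transClosure S).trans, ?_⟩
  rintro h ⟨a, b⟩ (hab : Relation.TransGen _ a b)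
  induction hab with
  | single hb => exact h hb
  | tail _ hc ih => exact SetRel.trans R.1 ih (h hc)

lemma comp_subset_iff (R : OrderRel E) {P Q : SetRel E E} [P.IsRefl] [Q.IsRefl] :
    P ○ Q ⊆ R.1 ↔ P ⊆ R.1 ∧ Q ⊆ R.1 :=
  ⟨fun h => ⟨SetRel.left_subset_comp.trans h, SetRel.right_subset_comp.trans h⟩,
    fun h => (SetRel.comp_subset_comp h.1 h.2).trans SetRel.comp_subset_self⟩

/-- The reflexive relations contained in the order `R`. -/
def reflSubrel (R : OrderRel E) : Set (SetRel E E) := {Q | Q.IsRefl ∧ Q ⊆ R.1}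

lemma exists_injective_of_comp_mem_reflSubrel (R : OrderRel E) {Y : Type u} {A : SetRel E Y}
    {B : SetRel Y E} (h : A ○ B ∈ R.reflSubrel) :
    ∃ f : E → Y, Function.Injective f ∧ ∀ e, (e, f e) ∈ A ∧ (f e, e) ∈ B := by
  choose f hf using h.1.refl
  have hle {a b : E} (hab : f a = f b) : (a, b) ∈ R.1 :=
    h.2 ⟨f a, (hf a).1, hab ▸ (hf b).2⟩
  exact ⟨f, fun a b hab => R.antisymm (hle hab) (hle hab.symm), hf⟩

variable [Finite E]

lemma perm_eq_one (R : OrderRel E) {π : Equiv.Perm E} (h : ∀ e, (π e, e) ∈ R.1) : π = 1 := by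
  have hpow (n : ℕ) (x : E) : ((π ^ n) x, x) ∈ R.1 := by
    induction n with
    | zero => exact SetRel.rfl R.1
    | succ n ih =>
      rw [pow_succ', Equiv.Perm.mul_apply]
      exact SetRel.trans R.1 (h _) ih
  ext e
  refine R.antisymm (h e) ?_
  have hinv := hpow (orderOf π - 1) (π e)
  rwa [← Equiv.Perm.mul_apply, ← pow_succ, Nat.sub_add_cancel (orderOf_pos π),
    pow_orderOf_eq_one] at hinv

lemma exists_perm_of_comp_mem_reflSubrel (R : OrderRel E) {A B : SetRel E E}
    (h : A ○ B ∈ R.reflSubrel) : ∃ σ : Equiv.Perm E, ∀ e, (e, σ e) ∈ A ∧ (σ e, e) ∈ B := by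
  obtain ⟨f, hf, hAB⟩ := R.exists_injective_of_comp_mem_reflSubrel h
  exact ⟨Equiv.ofBijective f (Finite.injective_iff_bijective.1 hf), hAB⟩

/- The left to right direction matches `E` with itself along `A` and `S ○ B`, and along `A ○ S` and
`B`; the two permutations differ by one that is decreasing for `R`, so they are equal. -/
lemma comp_comp_mem_reflSubrel_iff (R : OrderRel E) {A B S : SetRel E E} [S.IsRefl] :
    A ○ S ○ B ∈ R.reflSubrel ↔ (A ○ B).IsRefl ∧ A ○ S ○ B ⊆ R.1 := by
  have hAB : A ○ B ⊆ A ○ S ○ B := SetRel.comp_subset_comp_left SetRel.left_subset_comp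
  refine ⟨fun h => ⟨?_, h.2⟩, fun ⟨hrefl, hR⟩ => ⟨SetRel.isRefl_mono hAB, hR⟩⟩
  obtain ⟨τ, hτ⟩ := R.exists_perm_of_comp_mem_reflSubrel h
  obtain ⟨σ, hσ⟩ := R.exists_perm_of_comp_mem_reflSubrel (SetRel.comp_assoc A S B ▸ h)
  have hστ : σ⁻¹ * τ = 1 := R.perm_eq_one fun e => by
    refine h.2 (hAB ⟨τ e, ?_, (hτ e).2⟩)
    simpa using (hσ ((σ⁻¹ * τ) e)).1
  obtain rfl := inv_mul_eq_one.1 hστ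
  exact ⟨fun e => ⟨σ e, (hσ e).1, (hτ e).2⟩⟩

lemma comp_mem_reflSubrel_iff (R : OrderRel E) {Q S : SetRel E E} [S.IsRefl] :
    Q ○ S ∈ R.reflSubrel ↔ Q ∈ R.reflSubrel ∧ S ⊆ R.1 := by
  have h := R.comp_comp_mem_reflSubrel_iff (A := Q) (B := .id) (S := S)
  rw [SetRel.comp_id, SetRel.comp_id] at h
  rw [h, reflSubrel, Set.mem_ofPred_eq, and_assoc]
  exact and_congr_right fun _ => R.comp_subset_iff

lemma comp_transClosure_comp_mem_reflSubrel_iff (R : OrderRel E) {A B S : SetRel E E}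
    [S.IsRefl] : A ○ transClosure S ○ B ∈ R.reflSubrel ↔ A ○ S ○ B ∈ R.reflSubrel := by
  simp only [comp_comp_mem_reflSubrel_iff]
  refine and_congr_right fun hrefl => ⟨fun h => ?_, fun hR => ?_⟩
  · exact (SetRel.comp_subset_comp_left (SetRel.comp_subset_comp_right
      (subset_transClosure S))).trans h
  have hAB : A ○ B ⊆ A ○ S ○ B := SetRel.comp_subset_comp_left SetRel.left_subset_comp
  obtain ⟨σ, hσ⟩ := R.exists_perm_of_comp_mem_reflSubrel ⟨hrefl, hAB.trans hR⟩
  rintro ⟨e, e'⟩ ⟨y', ⟨y, hey, hyy' : Relation.TransGen _ y y'⟩, hye'⟩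
  induction hyy' generalizing e' with
  | single hyz => exact hR ⟨_, ⟨y, hey, hyz⟩, hye'⟩
  | @tail z z' _ hzz' ih =>
    have hσz := hσ (σ.symm z)
    rw [Equiv.apply_symm_apply] at hσz
    exact SetRel.trans R.1 (ih _ hσz.2) (hR ⟨z', ⟨z, hσz.1, hzz'⟩, hye'⟩)

end OrderRel

end Relations

section Inessential

variable {E : Type u}

/-- The graph `{(τ e, e)}` of a permutation, as a relation on `E`. -/
def permRel (τ : Equiv.Perm E) : SetRel E E := {p | p.1 = τ p.2}

lemma permRel_inv_comp_isRefl_iff (τ : Equiv.Perm E) (Q : SetRel E E) :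
    (permRel τ⁻¹ ○ Q).IsRefl ↔ permRel τ ⊆ Q := by
  refine ⟨?_, fun h => ⟨fun e => ⟨τ e, by simp [permRel], h rfl⟩⟩⟩
  rintro h ⟨x, e⟩ (rfl : x = τ e)
  obtain ⟨y, hy : e = τ⁻¹ y, hye⟩ := h.refl e
  rwa [hy, Equiv.Perm.coe_inv, Equiv.apply_symm_apply, ← Equiv.Perm.coe_inv, ← hy]

lemma permRel_comp_permRel_inv_comp (τ : Equiv.Perm E) (Q : SetRel E E) :
    permRel τ ○ (permRel τ⁻¹ ○ Q) = Q := by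
  ext ⟨a, b⟩
  simp [permRel]

variable [Finite E]

lemma IsInessential.comp {Y : Type u} [Finite Y] (hY : Nat.card Y < Nat.card E)
    (A : SetRel E Y) (B : SetRel Y E) : IsInessential (A ○ B) :=
  ⟨FinCorr.mk Y, B, A, hY, rfl⟩

lemma IsInessential.of_preimage_subset {Q : SetRel E E} {A N : Finset E}
    (hN : Q.preimage A ⊆ N) (hcard : N.card < A.card) : IsInessential Q := by
  classical
  let P : SetRel E (N ⊕ {a // a ∉ A}) := {p | p.2.elim (p.1 = ·.1) (fun a => (p.1, a.1) ∈ Q)}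
  let S : SetRel (N ⊕ {a // a ∉ A}) E :=
    {p | p.1.elim (fun b => p.2 ∈ A ∧ (b.1, p.2) ∈ Q) (·.1 = p.2)}
  have hPS : Q = P ○ S := by
    ext ⟨x, e⟩
    refine ⟨fun hxe => ?_, ?_⟩
    · by_cases he : e ∈ A
      · exact ⟨.inl ⟨x, hN ⟨e, he, hxe⟩⟩, rfl, he, hxe⟩
      · exact ⟨.inr ⟨e, he⟩, hxe, rfl⟩
    · rintro ⟨b | a, hP, hS⟩
      · obtain rfl : x = b.1 := hP
        exact hS.2
      · obtain rfl : a.1 = e := hS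
        exact hP
  rw [hPS]
  refine IsInessential.comp ?_ P S
  have := Fintype.ofFinite E
  have hA := Finset.card_le_univ A
  simp only [Nat.card_eq_fintype_card, Fintype.card_sum, Fintype.card_coe,
    Fintype.card_subtype_compl]
  omega

lemma isInessential_or_exists_permRel_subset (Q : SetRel E E) :
    IsInessential Q ∨ ∃ τ : Equiv.Perm E, permRel τ ⊆ Q := by
  classical
  have := Fintype.ofFinite E
  let preimage (A : Finset E) : Finset E := {b | ∃ a ∈ A, (b, a) ∈ Q}
  by_cases hall : ∀ A : Finset E, A.card ≤ (preimage A).card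
  · right
    obtain ⟨f, hf, hQ⟩ :=
      (Fintype.all_card_le_filter_rel_iff_exists_injective fun a b => (b, a) ∈ Q).1 hall
    refine ⟨Equiv.ofBijective f (Finite.injective_iff_bijective.1 hf), ?_⟩
    rintro ⟨x, e⟩ (hx : x = f e)
    exact hx ▸ hQ e
  · left
    push Not at hall
    obtain ⟨A, hA⟩ := hall
    refine .of_preimage_subset (fun b hb => ?_) hA
    simpa [preimage] using hb

lemma IsInessential.of_not_antisymm {S : SetRel E E} [S.IsRefl] [S.IsTrans] {a b : E}
    (hab : (a, b) ∈ S) (hba : (b, a) ∈ S) (hne : a ≠ b) : IsInessential S := by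
  let P : SetRel E {x // x ≠ b} := {p | (p.1, p.2.1) ∈ S}
  let P' : SetRel {x // x ≠ b} E := {p | (p.1.1, p.2) ∈ S}
  have hS : S = P ○ P' := by
    ext ⟨x, e⟩
    refine ⟨fun hxe => ?_, fun ⟨y, hxy, hye⟩ => SetRel.trans S hxy hye⟩
    by_cases he : e = b
    · subst he
      exact ⟨⟨a, hne⟩, SetRel.trans S hxe hba, hab⟩
    · exact ⟨⟨e, he⟩, hxe, SetRel.rfl S⟩
  rw [hS]
  refine IsInessential.comp ?_ P P'
  exact Finite.card_subtype_lt (x := b) (not_not.2 rfl)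

lemma OrderRel.notMem_reflSubrel_of_isInessential (R : OrderRel E) {Q : SetRel E E}
    (hQ : IsInessential Q) (A B : SetRel E E) : A ○ Q ○ B ∉ R.reflSubrel := by
  obtain ⟨Y, S, P, hY, rfl⟩ := hQ
  intro h
  change A ○ (SetRel.comp P S) ○ B ∈ R.reflSubrel at h
  rw [← SetRel.comp_assoc, SetRel.comp_assoc] at h
  obtain ⟨f, hf, -⟩ := R.exists_injective_of_comp_mem_reflSubrel h
  exact hY.not_ge (Nat.card_le_card_of_injective f hf)

lemma OrderRel.permRel_inv_comp_mem_reflSubrel_iff (R : OrderRel E) {Q : SetRel E E}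
    {τ : Equiv.Perm E} (hτ : permRel τ ⊆ Q) (σ : Equiv.Perm E) :
    permRel σ⁻¹ ○ Q ∈ R.reflSubrel ↔ σ = τ ∧ permRel τ⁻¹ ○ Q ⊆ R.1 := by
  refine ⟨fun h => ?_, ?_⟩
  · have hστ : σ⁻¹ * τ = 1 := R.perm_eq_one fun e =>
      h.2 ⟨τ e, by simp [permRel], hτ rfl⟩
    obtain rfl := inv_mul_eq_one.1 hστ
    exact ⟨rfl, h.2⟩
  · rintro ⟨rfl, h⟩
    exact ⟨(permRel_inv_comp_isRefl_iff σ Q).2 hτ, h⟩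

end Inessential

section Moebius

variable {k P M : Type*} [CommRing k] [PartialOrder P] [Fintype P] [LocallyFiniteOrder P]
  [DecidableEq P] [DecidableLE P] [AddCommGroup M] [Module k M]

lemma sum_ge_sum_mu_smul (g : P → M) (x : P) :
    ∑ y with x ≤ y, ∑ z, IncidenceAlgebra.mu k y z • g z = g x := by
  have hmu (z : P) : ∑ y with x ≤ y, IncidenceAlgebra.mu k y z = if x = z then 1 else 0 := by
    rw [← IncidenceAlgebra.sum_Icc_mu_left]
    refine (Finset.sum_subset (fun y hy => ?_) fun y hy hyz => ?_).symm
    · simpa using (Finset.mem_Icc.1 hy).1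
    · refine IncidenceAlgebra.apply_eq_zero_of_not_le (fun h => hyz ?_) _
      exact Finset.mem_Icc.2 ⟨by simpa using hy, h⟩
  rw [Finset.sum_comm]
  simp [← Finset.sum_smul, hmu]

variable (k) in
lemma sum_mu_smul_sum_ge (g : P → M) (x : P) :
    ∑ y, IncidenceAlgebra.mu k x y • ∑ z with y ≤ z, g z = g x := by
  have hmu (z : P) : ∑ y with y ≤ z, IncidenceAlgebra.mu k x y = if x = z then 1 else 0 := by
    rw [← IncidenceAlgebra.sum_Icc_mu_right]
    refine (Finset.sum_subset (fun y hy => ?_) fun y hy hyz => ?_).symm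
    · simpa using (Finset.mem_Icc.1 hy).2
    · refine IncidenceAlgebra.apply_eq_zero_of_not_le (fun h => hyz ?_) _
      exact Finset.mem_Icc.2 ⟨h, by simpa using hy⟩
  simp only [Finset.smul_sum, Finset.sum_filter]
  rw [Finset.sum_comm]
  simp [← Finset.sum_filter, ← Finset.sum_smul, hmu]

end Moebius

section RelationAlgebra

variable (k : Type v) [CommRing k]

namespace LinCorr

variable {X Y Z : Type u} [Finite X] [Finite Y] [Finite Z]

lemma corr_comp_corr (S : SetRel Y X) (Q : SetRel Z Y) :
    corr k S ≫ corr k Q = corr k (Q ○ S) :=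
  ((Free.embedding k FinCorr).map_comp (X := FinCorr.mk X) (Y := FinCorr.mk Y)
    (Z := FinCorr.mk Z) S Q).symm

variable (X Y) in
/-- The basis of the module of morphisms from `X` to `Y` in the linearized category which consists
of the correspondences. -/
def corrBasis : Module.Basis (Set (Y × X)) k (LinCorr.of k X ⟶ LinCorr.of k Y) :=
  Finsupp.basisSingleOne

@[simp] lemma corrBasis_apply (Q : Set (Y × X)) : corrBasis k X Y Q = corr k Q :=
  congrFun Finsupp.coe_basisSingleOne Q

end LinCorr

variable {E : Type u} [Finite E]

namespace RelAlg

variable (E) in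
/-- The basis of `k𝒞(E, E)` which consists of the relations. -/
def relBasis : Module.Basis (Set (E × E)) k (RelAlg k E) := LinCorr.corrBasis k E E

@[simp] lemma relBasis_apply (Q : Set (E × E)) : relBasis k E Q = rel k Q :=
  LinCorr.corrBasis_apply k Q

lemma rel_mul_rel (A B : SetRel E E) : rel k A * rel k B = rel k (A ○ B) :=
  LinCorr.corr_comp_corr k B A

variable {k} in
lemma map_mul_mul_eq_zero {M : Type*} [AddCommGroup M] [Module k M] {f : RelAlg k E →ₗ[k] M}
    {x : RelAlg k E} (h : ∀ A B, f (rel k A * x * rel k B) = 0) (b c : RelAlg k E) :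
    f (b * x * c) = 0 := by
  have hleft (A) : f ∘ₗ LinearMap.mulLeft k (rel k A * x) = 0 :=
    (relBasis k E).ext fun B => by simpa using h A B
  have hright : f ∘ₗ LinearMap.mulRight k (x * c) = 0 :=
    (relBasis k E).ext fun A => by simpa [mul_assoc] using LinearMap.congr_fun (hleft A) c
  simpa [mul_assoc] using LinearMap.congr_fun hright b

end RelAlg

lemma map_eq_zero_of_mem_twoSidedIdeal_span {A M : Type*} [Ring A] [AddCommGroup M] (f : A →+ M)
    {s : Set A} (h : ∀ x ∈ s, ∀ b c, f (b * x * c) = 0) {a : A}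
    (ha : a ∈ TwoSidedIdeal.span s) : f a = 0 := by
  rw [TwoSidedIdeal.mem_span_iff_mem_addSubgroup_closure] at ha
  suffices hle : AddSubgroup.closure _ ≤ f.ker from hle ha
  rw [AddSubgroup.closure_le]
  rintro _ ⟨_, ⟨b, -, x, hx, rfl⟩, c, -, rfl⟩
  exact h x hx b c

open Classical in
/-- The linear form on `k𝒞(E, E)` equal to `1` at the reflexive relations contained in the order
`R` and to `0` at the other relations. -/
def OrderRel.reflForm (R : OrderRel E) : RelAlg k E →ₗ[k] k :=
  (RelAlg.relBasis k E).constr k fun Q => if Q ∈ R.reflSubrel then 1 else 0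

namespace OrderRel

variable (R : OrderRel E)

open Classical in
lemma reflForm_rel (Q : Set (E × E)) :
    R.reflForm k (RelAlg.rel k Q) = if Q ∈ R.reflSubrel then 1 else 0 := by
  rw [reflForm, ← RelAlg.relBasis_apply, Module.Basis.constr_basis]

lemma reflForm_eq_zero_of_mem_inessentialIdeal {a : RelAlg k E}
    (ha : a ∈ inessentialIdeal k E) : R.reflForm k a = 0 := by
  refine map_eq_zero_of_mem_twoSidedIdeal_span (R.reflForm k).toAddMonoidHom ?_ ha
  rintro _ ⟨Q, hQ, rfl⟩
  refine RelAlg.map_mul_mul_eq_zero (f := R.reflForm k) fun A B => ?_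
  rw [RelAlg.rel_mul_rel, RelAlg.rel_mul_rel, reflForm_rel]
  exact if_neg (R.notMem_reflSubrel_of_isInessential hQ A B)

lemma reflForm_eq_zero_of_mem_closureIdeal {a : RelAlg k E}
    (ha : a ∈ closureIdeal k E) : R.reflForm k a = 0 := by
  refine map_eq_zero_of_mem_twoSidedIdeal_span (R.reflForm k).toAddMonoidHom ?_ ha
  classical
  rintro _ ⟨S, hS, rfl⟩
  have : SetRel.IsRefl S := ⟨hS⟩
  refine RelAlg.map_mul_mul_eq_zero (f := R.reflForm k) fun A B => ?_
  rw [mul_sub, sub_mul, map_sub, sub_eq_zero]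
  rw [RelAlg.rel_mul_rel, RelAlg.rel_mul_rel, RelAlg.rel_mul_rel, RelAlg.rel_mul_rel,
    reflForm_rel, reflForm_rel]
  exact if_congr R.comp_transClosure_comp_mem_reflSubrel_iff.symm rfl rfl

lemma reflForm_eq_of_proj_eq {a b : RelAlg k E}
    (h : PermOrderAlg.proj k E a = PermOrderAlg.proj k E b) :
    R.reflForm k a = R.reflForm k b := by
  have hmem := (TwoSidedIdeal.rel_iff _ _ _).1 ((RingCon.eq _).1 h)
  obtain ⟨x, hx, y, hy, hxy⟩ := TwoSidedIdeal.mem_sup.1 hmem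
  rw [← sub_eq_zero, ← map_sub, ← hxy, map_add, reflForm_eq_zero_of_mem_inessentialIdeal k R hx,
    reflForm_eq_zero_of_mem_closureIdeal k R hy, add_zero]

end OrderRel

namespace PermOrderAlg

variable {k} in
lemma proj_surjective : Function.Surjective (proj k E) := RingCon.mk'_surjective _

lemma proj_smul (r : k) (a : RelAlg k E) : proj k E (r • a) = r • proj k E a := rfl

variable {k} in
lemma linearMap_ext {M : Type*} [AddCommGroup M] [Module k M] {f g : PermOrderAlg k E →ₗ[k] M}
    (h : ∀ Q : SetRel E E, f (proj k E (RelAlg.rel k Q)) = g (proj k E (RelAlg.rel k Q))) :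
    f = g := by
  let π : RelAlg k E →ₗ[k] PermOrderAlg k E := { proj k E with map_smul' := proj_smul k }
  have hπ : f ∘ₗ π = g ∘ₗ π :=
    (RelAlg.relBasis k E).ext fun Q => by rw [RelAlg.relBasis_apply]; exact h Q
  refine LinearMap.ext fun p => ?_
  obtain ⟨a, rfl⟩ := proj_surjective p
  exact LinearMap.congr_fun hπ a

lemma proj_rel_mul_proj_rel (A B : SetRel E E) :
    proj k E (RelAlg.rel k A) * proj k E (RelAlg.rel k B) = proj k E (RelAlg.rel k (A ○ B)) := by
  rw [← map_mul, RelAlg.rel_mul_rel]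

lemma proj_rel_of_isInessential {Q : Set (E × E)} (h : IsInessential Q) :
    proj k E (RelAlg.rel k Q) = 0 :=
  (RingCon.eq _).2 (TwoSidedIdeal.mem_sup_left (TwoSidedIdeal.subset_span ⟨Q, h, rfl⟩))

lemma proj_rel_transClosure (S : SetRel E E) [S.IsRefl] :
    proj k E (RelAlg.rel k (transClosure S)) = proj k E (RelAlg.rel k S) := by
  refine ((RingCon.eq _).2 ((TwoSidedIdeal.rel_iff _ _ _).2 ?_)).symm
  exact TwoSidedIdeal.mem_sup_right (TwoSidedIdeal.subset_span ⟨S, fun _ => S.rfl, rfl⟩)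

/-- The linear form on `𝒫_E` induced by `OrderRel.reflForm`. -/
def reflForm (R : OrderRel E) : PermOrderAlg k E →ₗ[k] k where
  toFun := Quotient.lift (R.reflForm k) fun _ _ h => R.reflForm_eq_of_proj_eq k (Quotient.sound h)
  map_add' := by
    rintro ⟨a⟩ ⟨b⟩
    exact map_add (R.reflForm k) a b
  map_smul' := by
    rintro r ⟨a⟩
    exact map_smul (R.reflForm k) r a

lemma reflForm_proj (R : OrderRel E) (a : RelAlg k E) :
    reflForm k R (proj k E a) = R.reflForm k a := rfl

end PermOrderAlg

end RelationAlgebra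

section Idempotents

variable (k : Type v) [CommRing k] {E : Type u} [Finite E]

open Classical in
lemma fundIdempotent_eq_sum [Fintype (OrderRel E)] [LocallyFiniteOrder (OrderRel E)]
    (R : OrderRel E) : fundIdempotent k R =
      ∑ S, IncidenceAlgebra.mu k R S • PermOrderAlg.proj k E (RelAlg.rel k S.1) := by
  rw [fundIdempotent, Subsingleton.elim (Fintype.ofFinite _) ‹Fintype (OrderRel E)›,
    Subsingleton.elim Fintype.toLocallyFiniteOrder ‹LocallyFiniteOrder (OrderRel E)›]
  refine Finset.sum_congr rfl fun S _ => ite_eq_left_iff.2 fun h => ?_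
  rw [IncidenceAlgebra.apply_eq_zero_of_not_le h, zero_smul]

namespace PermOrderAlg

open Classical in
lemma proj_rel_orderRel [Fintype (OrderRel E)] (R : OrderRel E) :
    proj k E (RelAlg.rel k R.1) = ∑ S with R ≤ S, fundIdempotent k S := by
  let : LocallyFiniteOrder (OrderRel E) := Fintype.toLocallyFiniteOrder
  simp only [fundIdempotent_eq_sum]
  exact (sum_ge_sum_mu_smul (k := k) (fun S : OrderRel E => proj k E (RelAlg.rel k S.1)) R).symm

open Classical in
lemma proj_rel_of_isRefl [Fintype (OrderRel E)] (S : SetRel E E) [S.IsRefl] :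
    proj k E (RelAlg.rel k S) = ∑ V : OrderRel E with S ⊆ V.1, fundIdempotent k V := by
  rw [← proj_rel_transClosure, Finset.filter_congr fun V _ => V.transClosure_subset_iff.symm]
  by_cases h : ∀ a b, (a, b) ∈ transClosure S → (b, a) ∈ transClosure S → a = b
  · exact proj_rel_orderRel k ⟨transClosure S, fun _ => SetRel.rfl (transClosure S), h,
      fun _ _ _ => SetRel.trans (transClosure S)⟩
  · push Not at h
    obtain ⟨a, b, hab, hba, hne⟩ := h
    rw [proj_rel_of_isInessential k (IsInessential.of_not_antisymm hab hba hne),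
      Finset.filter_false_of_mem fun V _ hV => hne (V.antisymm (hV hab) (hV hba)),
      Finset.sum_empty]

open Classical in
/- Both sides have the same sum over the orders containing any given order `R`, as
`S ○ R ⊆ V` if and only if `R ⊆ V` and `S ⊆ V`. -/
lemma proj_rel_mul_fundIdempotent (S : SetRel E E) [S.IsRefl] (R : OrderRel E) :
    proj k E (RelAlg.rel k S) * fundIdempotent k R =
      if S ⊆ R.1 then fundIdempotent k R else 0 := by
  let : Fintype (OrderRel E) := Fintype.ofFinite _
  let : LocallyFiniteOrder (OrderRel E) := Fintype.toLocallyFiniteOrder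
  have hsum (R : OrderRel E) :
      ∑ V with R ≤ V, proj k E (RelAlg.rel k S) * fundIdempotent k V =
        ∑ V with R ≤ V, if S ⊆ V.1 then fundIdempotent k V else 0 := by
    rw [← Finset.mul_sum, ← proj_rel_orderRel, proj_rel_mul_proj_rel, proj_rel_of_isRefl,
      ← Finset.sum_filter, Finset.filter_filter]
    simp only [OrderRel.comp_subset_iff, and_comm]
    rfl
  rw [← sum_mu_smul_sum_ge k (fun V => proj k E (RelAlg.rel k S) * fundIdempotent k V) R,
    ← sum_mu_smul_sum_ge k (fun V => if S ⊆ V.1 then fundIdempotent k V else 0) R]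
  simp only [hsum]

lemma reflForm_mul_fundIdempotent (R : OrderRel E) (p : PermOrderAlg k E) :
    reflForm k R (p * fundIdempotent k R) = reflForm k R p := by
  let : Fintype (OrderRel E) := Fintype.ofFinite _
  classical
  let : LocallyFiniteOrder (OrderRel E) := Fintype.toLocallyFiniteOrder
  suffices h : reflForm k R ∘ₗ LinearMap.mulRight k (fundIdempotent k R) = reflForm k R from
    LinearMap.congr_fun h p
  refine linearMap_ext fun Q => ?_
  simp only [LinearMap.comp_apply, LinearMap.mulRight_apply, fundIdempotent_eq_sum,
    Finset.mul_sum, mul_smul_comm, map_sum, map_smul, proj_rel_mul_proj_rel, reflForm_proj,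
    OrderRel.reflForm_rel]
  rw [Finset.sum_eq_single R]
  · rw [IncidenceAlgebra.mu_self, one_smul]
    simp only [R.comp_mem_reflSubrel_iff, subset_rfl, and_true]
  · intro S _ hne
    by_cases hRS : R ≤ S
    · rw [if_neg, smul_zero]
      exact fun h => hne (le_antisymm (R.comp_mem_reflSubrel_iff.1 h).2 hRS)
    · rw [IncidenceAlgebra.apply_eq_zero_of_not_le hRS, zero_smul]
  · simp

open Classical in
lemma mul_fundIdempotent_eq_sum [Fintype (Equiv.Perm E)] (R : OrderRel E)
    (p : PermOrderAlg k E) : p * fundIdempotent k R =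
      ∑ σ : Equiv.Perm E, reflForm k R (proj k E (RelAlg.rel k (permRel σ⁻¹)) * p) •
        (proj k E (RelAlg.rel k (permRel σ)) * fundIdempotent k R) := by
  let coeff (σ : Equiv.Perm E) : PermOrderAlg k E →ₗ[k] k :=
    reflForm k R ∘ₗ LinearMap.mulLeft k (proj k E (RelAlg.rel k (permRel σ⁻¹)))
  suffices h : LinearMap.mulRight k (fundIdempotent k R) = ∑ σ, (coeff σ).smulRight
      (proj k E (RelAlg.rel k (permRel σ)) * fundIdempotent k R) by
    simpa [coeff] using LinearMap.congr_fun h p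
  refine linearMap_ext fun Q => ?_
  simp only [LinearMap.mulRight_apply, LinearMap.sum_apply, LinearMap.smulRight_apply, coeff,
    LinearMap.comp_apply, LinearMap.mulLeft_apply]
  obtain hQ | ⟨τ, hτ⟩ := isInessential_or_exists_permRel_subset Q
  · simp [proj_rel_of_isInessential k hQ]
  · have := (permRel_inv_comp_isRefl_iff τ Q).2 hτ
    simp only [proj_rel_mul_proj_rel, reflForm_proj, OrderRel.reflForm_rel,
      R.permRel_inv_comp_mem_reflSubrel_iff hτ, ite_and, ite_smul, zero_smul,
      Finset.sum_ite_eq', Finset.mem_univ, if_true]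
    rw [← permRel_comp_permRel_inv_comp τ Q, ← proj_rel_mul_proj_rel, mul_assoc,
      proj_rel_mul_fundIdempotent]
    simp [permRel_comp_permRel_inv_comp]

end PermOrderAlg

lemma PermOrderAlg.mul_fundIdempotent_eq_zero_iff (R : OrderRel E) (p : PermOrderAlg k E) :
    p * fundIdempotent k R = 0 ↔ ∀ q, reflForm k R (q * p) = 0 := by
  let : Fintype (OrderRel E) := Fintype.ofFinite _
  let : Fintype (Equiv.Perm E) := Fintype.ofFinite _
  refine ⟨fun h q => ?_, fun h => ?_⟩
  · rw [← reflForm_mul_fundIdempotent, mul_assoc, h, mul_zero, map_zero]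
  · rw [mul_fundIdempotent_eq_sum]
    simp [h]

/-- The generator `f_R` of the fundamental module `𝒫_E f_R`. -/
def FundModule.generator (R : OrderRel E) : FundModule k R :=
  ⟨fundIdempotent k R, Ideal.subset_span rfl⟩

namespace FundModule

variable {k}

lemma exists_eq_smul_generator {R : OrderRel E} (y : FundModule k R) :
    ∃ a : RelAlg k E, y = a • generator k R := by
  obtain ⟨p, hp⟩ := Ideal.mem_span_singleton'.1 y.2
  obtain ⟨a, rfl⟩ := PermOrderAlg.proj_surjective p
  exact ⟨a, Subtype.ext hp.symm⟩

lemma smul_generator_eq_zero_iff {R : OrderRel E} {a : RelAlg k E} :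
    a • generator k R = 0 ↔ ∀ b : RelAlg k E, R.reflForm k (b * a) = 0 := by
  refine Subtype.ext_iff.trans
    ((PermOrderAlg.mul_fundIdempotent_eq_zero_iff k R (PermOrderAlg.proj k E a)).trans ?_)
  simp only [PermOrderAlg.proj_surjective.forall, ← map_mul, PermOrderAlg.reflForm_proj]

end FundModule

end Idempotents

section InclusionExclusion

lemma sum_neg_one_pow_card_ite {ι k : Type*} [Fintype ι] [DecidableEq ι] [CommRing k]
    {p q : ι → Prop} [DecidablePred p] [DecidablePred q] (hpq : ∀ i, p i → q i) :
    ∑ A : Finset ι, (if (∀ i ∈ A, p i) ∧ ∀ i ∉ A, q i then (-1 : k) ^ A.card else 0) =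
      if ∀ i, q i ∧ ¬ p i then 1 else 0 := by
  have hprod : ∏ i, ((if p i then (-1 : k) else 0) + if q i then 1 else 0) =
      if ∀ i, q i ∧ ¬ p i then 1 else 0 := by
    have hfactor (i) : ((if p i then (-1 : k) else 0) + if q i then 1 else 0) =
        if q i ∧ ¬ p i then 1 else 0 := by
      have := hpq i
      by_cases hp : p i <;> simp_all
    simp only [hfactor, Fintype.prod_ite_zero, Finset.prod_const_one]
  rw [← hprod, Finset.prod_add, Finset.powerset_univ]
  refine Finset.sum_congr rfl fun A _ => ?_
  rw [Finset.prod_ite_zero, Finset.prod_ite_zero, Finset.prod_const, Finset.prod_const_one,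
    ite_zero_mul_ite_zero, mul_one]
  simp only [Finset.mem_sdiff, Finset.mem_univ, true_and]

end InclusionExclusion

section Pairing

variable (k : Type v) [CommRing k]

open Classical in
/-- The linear form on the free module with basis a poset which sums the coefficients at the
elements below `a`. -/
def sumBelow {P : Type*} [PartialOrder P] (a : P) : (P →₀ k) →ₗ[k] k :=
  Finsupp.linearCombination k fun b => if b ≤ a then 1 else 0

open Classical in
lemma sumBelow_single {P : Type*} [PartialOrder P] (a b : P) (r : k) :
    sumBelow k a (Finsupp.single b r) = if b ≤ a then r else 0 := by
  simp [sumBelow]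

variable {k} in
lemma eq_zero_of_sumBelow_eq_zero {P : Type*} [PartialOrder P] {v : P →₀ k}
    (h : ∀ a, sumBelow k a v = 0) : v = 0 := by
  by_contra hv
  obtain ⟨a, ha⟩ := v.support.exists_minimal (Finsupp.support_nonempty_iff.2 hv)
  refine Finsupp.mem_support_iff.1 ha.prop ?_
  rw [← h a, sumBelow, Finsupp.linearCombination_apply, Finsupp.sum,
    Finset.sum_eq_single_of_mem a ha.prop]
  · simp
  · intro b hb hne
    rw [if_neg fun hle => hne (le_antisymm hle (ha.le_of_le hb hle)), smul_zero]

lemma latticeFunctor_map_corr_single {T : Type u} [SemilatticeSup T] [OrderBot T] {X Y : Type u}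
    [Finite X] [Finite Y] (Q : Set (Y × X)) (φ : X → T) (r : k) :
    ((latticeFunctor k T).map (LinCorr.corr k Q)).hom (Finsupp.single φ r) =
      Finsupp.single (corrAct Q φ) r :=
  (corrActLin_single k T (X := FinCorr.mk X) (Y := FinCorr.mk Y) Q 1 r φ).trans
    (by rw [one_mul])

variable {T : Type u} [Lattice T] [BoundedOrder T] {X Y : Type u} [Finite X] [Finite Y]

lemma corrAct_le_toDual_iff (Q : SetRel Y X) (ψ : X → Tᵒᵈ) (φ : Y → T) :
    corrAct Q ψ ≤ OrderDual.toDual ∘ φ ↔ ψ ≤ OrderDual.toDual ∘ corrAct Q.inv φ := by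
  have h (x) : ψ x ≤ OrderDual.toDual (corrAct Q.inv φ x) ↔
      ∀ y, (y, x) ∈ Q → ψ x ≤ OrderDual.toDual (φ y) :=
    corrAct_le_iff Q.inv φ x (OrderDual.ofDual (ψ x))
  simp only [Pi.le_def, Function.comp_apply, corrAct_le_iff, h]
  exact forall_comm

lemma sumBelow_map_corr (Q : SetRel Y X) (φ : Y → T)
    (v : (latticeFunctor k Tᵒᵈ).obj (LinCorr.of k X)) :
    sumBelow k (OrderDual.toDual ∘ φ) (((latticeFunctor k Tᵒᵈ).map (LinCorr.corr k Q)).hom v) =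
      sumBelow k (OrderDual.toDual ∘ corrAct Q.inv φ) v := by
  suffices h : sumBelow k (OrderDual.toDual ∘ φ) ∘ₗ
      ((latticeFunctor k Tᵒᵈ).map (LinCorr.corr k Q)).hom =
        sumBelow k (OrderDual.toDual ∘ corrAct Q.inv φ) from LinearMap.congr_fun h v
  classical
  refine Finsupp.lhom_ext fun (ψ : X → Tᵒᵈ) r => ?_
  refine (congrArg (sumBelow k _) (latticeFunctor_map_corr_single k Q ψ r)).trans ?_
  refine (sumBelow_single k _ (corrAct Q ψ) r).trans (.trans ?_ (sumBelow_single k _ ψ r).symm)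
  exact if_congr (corrAct_le_toDual_iff Q ψ φ) rfl rfl

end Pairing

section Gamma

variable (k : Type v) [CommRing k] {T : Type u} [Lattice T] [BoundedOrder T] [Finite T]

lemma le_rElem_iff {e t : T} (he : SupIrred e) : t ≤ rElem e ↔ t < e := by
  refine ⟨fun ht => ht.trans_lt (lt_of_le_of_ne ?_ fun heq => ?_), fun ht => ?_⟩
  · exact Finset.sup_le fun s hs => le_of_lt (by simpa using hs)
  · obtain ⟨s, hs, rfl⟩ := he.finset_sup_eq heq
    simp at hs
  · exact Finset.le_sup (f := id) (by simpa using ht)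

lemma le_etaMap_iff {χ : Irr T → T} {A : Finset (Irr T)} :
    χ ≤ etaMap A ↔ (∀ e ∈ A, χ e < e) ∧ ∀ e ∉ A, χ e ≤ e := by
  have h (e) : χ e ≤ etaMap A e ↔ (e ∈ A → χ e < e) ∧ (e ∉ A → χ e ≤ e) := by
    by_cases he : e ∈ A <;> simp [etaMap, he, le_rElem_iff e.2]
  simp only [Pi.le_def, h, forall_and]

lemma sumBelow_gammaElem (χ : Irr T → T) [Decidable (χ = Subtype.val)] :
    sumBelow k (OrderDual.toDual ∘ χ) (gammaElem k T) = if χ = Subtype.val then 1 else 0 := by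
  classical
  let : Fintype (Irr T) := Fintype.ofFinite _
  have hχ : χ = Subtype.val ↔ ∀ e : Irr T, χ e ≤ e ∧ ¬ χ e < e := by
    simp only [← eq_iff_le_not_lt, funext_iff]
  refine Eq.trans ?_ (if_congr hχ.symm rfl rfl)
  calc sumBelow k (OrderDual.toDual ∘ χ) (gammaElem k T)
    _ = ∑ A : Finset (Irr T), if χ ≤ etaMap A then (-1) ^ A.card else 0 :=
      (map_sum (sumBelow k _) _ _).trans
        (Finset.sum_congr rfl fun A _ => sumBelow_single k _ _ _)
    _ = ∑ A : Finset (Irr T),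
          if (∀ e ∈ A, χ e < e) ∧ ∀ e ∉ A, χ e ≤ e then (-1) ^ A.card else 0 := by
      simp only [le_etaMap_iff]
    _ = if ∀ e : Irr T, χ e ≤ e ∧ ¬ χ e < e then 1 else 0 :=
      sum_neg_one_pow_card_ite fun e => le_of_lt

lemma corrAct_inv_val_eq_val_iff (P : SetRel (Irr T) (Irr T)) :
    corrAct P.inv Subtype.val = Subtype.val ↔ P ∈ (irrOrder T).reflSubrel := by
  refine ⟨fun h => ⟨⟨fun e => ?_⟩, ?_⟩, fun h => funext fun e => le_antisymm ?_ ?_⟩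
  · obtain ⟨e', he', heq⟩ := e.2.finset_sup_eq (congrFun h e)
    obtain rfl : e' = e := Subtype.ext heq
    simpa using he'
  · rintro ⟨a, b⟩ hab
    exact (corrAct_le_iff _ _ _ _).1 (congrFun h b).le a hab
  · exact (corrAct_le_iff _ _ _ _).2 fun a ha => h.2 ha
  · exact (corrAct_le_iff P.inv _ e _).1 le_rfl e (h.1.refl e)

variable {X : Type u}

lemma corrAct_setOf_le_val (φ : X → T) :
    corrAct {p : X × Irr T | p.2 ≤ φ p.1} Subtype.val = φ := by
  refine funext fun x => le_antisymm ((corrAct_le_iff _ _ _ _).2 fun e he => he) ?_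
  obtain ⟨s, hs, hirr⟩ := exists_supIrred_decomposition (φ x)
  refine hs.ge.trans (Finset.sup_le fun b hb => ?_)
  exact (corrAct_le_iff _ Subtype.val x _).1 le_rfl ⟨b, hirr hb⟩
    ((Finset.le_sup (f := id) hb).trans_eq hs)

variable [Finite X]

lemma sumBelow_map_gammaElem (α : LinCorr.of k (Irr T) ⟶ LinCorr.of k X)
    (P : SetRel (Irr T) X) :
    sumBelow k (OrderDual.toDual ∘ corrAct P.inv Subtype.val)
        (((latticeFunctor k Tᵒᵈ).map α).hom (gammaElem k T)) =
      (irrOrder T).reflForm k (End.of (α ≫ LinCorr.corr k P)) := by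
  classical
  let f := sumBelow k (OrderDual.toDual ∘ corrAct P.inv (Subtype.val : Irr T → T)) ∘ₗ
    yonedaMap (F := latticeFunctor k Tᵒᵈ) (gammaElem k T) (LinCorr.of k X)
  let g := (irrOrder T).reflForm k ∘ₗ
    Linear.rightComp k (LinCorr.of k (Irr T)) (LinCorr.corr k P)
  suffices h : f = g from LinearMap.congr_fun h α
  refine (LinCorr.corrBasis k (Irr T) X).ext fun (Q : SetRel X (Irr T)) => ?_
  calc f (LinCorr.corrBasis k (Irr T) X Q)
    _ = sumBelow k (OrderDual.toDual ∘ corrAct P.inv Subtype.val)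
          (((latticeFunctor k Tᵒᵈ).map (LinCorr.corr k Q)).hom (gammaElem k T)) :=
      congrArg f (LinCorr.corrBasis_apply k Q)
    _ = sumBelow k (OrderDual.toDual ∘ corrAct (P ○ Q).inv Subtype.val) (gammaElem k T) := by
      rw [sumBelow_map_corr, SetRel.inv_comp]
      exact congrArg (fun φ => sumBelow k (OrderDual.toDual ∘ φ) (gammaElem k T))
        (corrAct_comp Q.inv P.inv Subtype.val).symm
    _ = (irrOrder T).reflForm k (RelAlg.rel k (P ○ Q)) := by
      rw [sumBelow_gammaElem, OrderRel.reflForm_rel]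
      exact if_congr (corrAct_inv_val_eq_val_iff _) rfl rfl
    _ = g (LinCorr.corrBasis k (Irr T) X Q) := by
      rw [LinCorr.corrBasis_apply]
      exact congrArg ((irrOrder T).reflForm k) (LinCorr.corr_comp_corr k Q P).symm

lemma map_gammaElem_eq_zero_iff (α : LinCorr.of k (Irr T) ⟶ LinCorr.of k X) :
    ((latticeFunctor k Tᵒᵈ).map α).hom (gammaElem k T) = 0 ↔
      ∀ ψ : LinCorr.of k X ⟶ LinCorr.of k (Irr T),
        (irrOrder T).reflForm k (End.of (α ≫ ψ)) = 0 := by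
  refine ⟨fun h => ?_, fun h => eq_zero_of_sumBelow_eq_zero fun φ => ?_⟩
  · suffices hzero : (irrOrder T).reflForm k ∘ₗ
        Linear.leftComp k (LinCorr.of k (Irr T)) α = 0 from LinearMap.congr_fun hzero
    refine (LinCorr.corrBasis k X (Irr T)).ext fun P => ?_
    rw [LinCorr.corrBasis_apply]
    refine (sumBelow_map_gammaElem k α P).symm.trans ?_
    rw [h]
    exact map_zero _
  · let χ : X → T := fun x => OrderDual.ofDual (φ x)
    change sumBelow k (OrderDual.toDual ∘ χ) _ = 0
    rw [← corrAct_setOf_le_val χ]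
    exact (sumBelow_map_gammaElem k α {p : Irr T × X | p.1.1 ≤ χ p.2}).trans (h _)

lemma map_gammaElem_eq_zero_iff_smul_generator (α : LinCorr.of k (Irr T) ⟶ LinCorr.of k X) :
    ((latticeFunctor k Tᵒᵈ).map α).hom (gammaElem k T) = 0 ↔
      ∀ ψ : LinCorr.of k X ⟶ LinCorr.of k (Irr T),
        End.of (α ≫ ψ) • FundModule.generator k (irrOrder T) = 0 := by
  simp only [map_gammaElem_eq_zero_iff, FundModule.smul_generator_eq_zero_iff]
  refine ⟨fun h ψ b => ?_, fun h ψ => ?_⟩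
  · rw [← h (ψ ≫ b.asHom), ← Category.assoc]
    rfl
  · rw [← h ψ 1, one_mul]

variable (T X) in
lemma generatedBy_gammaElem_obj :
    (ModSubfunctor.generatedBy (latticeFunctor k Tᵒᵈ) (gammaElem k T)).obj (LinCorr.of k X) =
      Submodule.span k (Set.range fun S : Set (X × Irr T) =>
        ((latticeFunctor k Tᵒᵈ).map (LinCorr.corr k S)).hom (gammaElem k T)) := by
  rw [generatedBy_obj_eq_range, LinearMap.range_eq_map, ← (LinCorr.corrBasis k _ X).span_eq,
    Submodule.map_span, ← Set.range_comp]
  simp only [Function.comp_def, LinCorr.corrBasis_apply]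
  rfl

end Gamma

end

theorem mainTheorem6 (k : Type v) [CommRing k]
    (T : Type u) [Lattice T] [BoundedOrder T] [Finite T] :
    Nonempty ((ModSubfunctor.generatedBy (latticeFunctor k Tᵒᵈ) (gammaElem k T)).toFunctor ≅
        fundamentalFunctor k (irrOrder T)) ∧
      ∀ (X : Type u) [Finite X],
        (ModSubfunctor.generatedBy (latticeFunctor k Tᵒᵈ) (gammaElem k T)).obj (LinCorr.of k X) =
            Submodule.span k (Set.range fun S : Set (X × Irr T) =>
              ((latticeFunctor k Tᵒᵈ).map (LinCorr.corr k S)).hom (gammaElem k T)) ∧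
          Nonempty ((fundamentalFunctor k (irrOrder T)).obj (LinCorr.of k X) ≃ₗ[k]
            Submodule.span k (Set.range fun S : Set (X × Irr T) =>
              ((latticeFunctor k Tᵒᵈ).map (LinCorr.corr k S)).hom (gammaElem k T))) := by
  have hiso : Nonempty
      ((ModSubfunctor.generatedBy (latticeFunctor k Tᵒᵈ) (gammaElem k T)).toFunctor ≅
        fundamentalFunctor k (irrOrder T)) := by
    refine nonempty_generatedBy_iso (gammaElem k T) FundModule.exists_eq_smul_generator ?_
    rintro ⟨X⟩ α
    exact map_gammaElem_eq_zero_iff_smul_generator k α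
  refine ⟨hiso, fun X _ => ⟨generatedBy_gammaElem_obj k T X, ?_⟩⟩
  obtain ⟨e⟩ := hiso
  exact ⟨(e.app (LinCorr.of k X)).toLinearEquiv.symm.trans
    (LinearEquiv.ofEq _ _ (generatedBy_gammaElem_obj k T X))⟩
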